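/- Let $[\gamma]^n$ denote the set of $n$-element subsets of an ordinal $\gamma$, identified with the set of strictly increasing $n$-tuples of elements of $\gamma$; a function $f:[\gamma]^{k+1}\to A$ to an abelian group $A$ is identified with the family of functions $f_\beta=f(\,\cdot\,,\beta):[\beta]^{k}\to A$ $(\beta<\gamma)$. A function $f:[\gamma]^1\to A$ is \emph{$0$-trivial} if its support is finite. For $n>0$, a family of functions $\mathcal S=\{s_\gamma:[\gamma]^n\to A\mid\gamma<\kappa\}$, with $\kappa$ an ordinal, is \emph{$n$-trivial} if there is a $t:[\kappa]^n\to A$ such that $t|_{[\gamma]^n}-s_\gamma$ is $(n-1)$-trivial for all $\gamma<\kappa$, and it is \emph{$n$-coherent} if $s_\delta|_{[\gamma]^n}-s_\gamma$ is $(n-1)$-trivial for all $\gamma\le\delta<\kappa$. A \emph{tree} is a partially ordered set $T$ in which the set of strict predecessors of each $t\in T$ is well-ordered; the order type of this set is the \emph{height} of $t$, and the height of $T$ is the least ordinal that is not the height of any element of $T$. A \emph{branch} of $T$ is a maximal linearly ordered subset $b$ of $T$; it is \emph{cofinal} if the least ordinal that is not the height in $T$ of any element of $b$ equals the height of $T$.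 An \emph{$n$-coherent tree} is a tree of the form $$T(\mathcal S)=\big(\{s_\gamma|_{[\beta]^n}\mid\beta\le\gamma<\kappa\},\subseteq\big)$$ for some abelian group $A$, some ordinal $\kappa$ and some $n$-coherent family $\mathcal S=\{s_\gamma:[\gamma]^n\to A\mid\gamma<\kappa\}$. It is \emph{nontrivial} if its uniform closure $$T^*(\mathcal S)=\Big(\bigcup_{\gamma<\kappa}\{u:[\gamma]^n\to A\mid u-s_\gamma\text{ is }(n-1)\text{-trivial}\},\subseteq\Big)$$ has no cofinal branch. Then for every integer $n>0$, the least ordinal $\varepsilon$ for which there exists a nontrivial $n$-coherent tree of height $\varepsilon$ is $\omega_n$. -/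

import Mathlib

/-! Trees, and higher-dimensional coherent trees of functions. -/

universe u v w

namespace CoherentTree

section Trees

variable {P : Type w} [PartialOrder P]

/-- In the tree with set of nodes `T` (ordered as a subset of `P`), the node `t` has height `α`:
the order type of the set of its strict predecessors in `T` is `α`. -/
def NodeHeight (T : Set P) (t : P) (α : Ordinal.{u}) : Prop :=
  Nonempty ({s : P // s ∈ T ∧ s < t} ≃o Set.Iio α)

/-- The least ordinal that is not the height (in `T`) of any element of `b` is `η`. -/
def HeightOfSubset (T b : Set P) (η : Ordinal.{u}) : Prop :=
  IsLeast {α : Ordinal.{u} | ¬ ∃ t ∈ b, NodeHeight T t α} η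

/-- The tree `T` has height `η`: the least `α` such that no node of `T` has height `α` is `η`. -/
def TreeHeight (T : Set P) (η : Ordinal.{u}) : Prop :=
  HeightOfSubset T T η

/-- A branch of `T` is a maximal linearly ordered subset of `T`. -/
def IsBranch (T b : Set P) : Prop :=
  Maximal (fun c : Set P => c ⊆ T ∧ IsChain (· ≤ ·) c) b

/-- The tree `T`, which is of height `ht(T)`, has a cofinal branch: a branch `b` such that
the least height not attained in `b` equals `ht(T)`. -/
def HasCofinalBranch (T : Set P) : Prop :=
  ∃ (b : Set P) (η : Ordinal.{u}), IsBranch T b ∧ TreeHeight T η ∧ HeightOfSubset T b η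

end Trees

/-- `[γ]^n`, the collection of `n`-element sets of ordinals below `γ`. -/
def subsets (γ : Ordinal.{u}) (n : ℕ) : Set (Finset Ordinal.{u}) :=
  {σ | σ.card = n ∧ ∀ α ∈ σ, α < γ}

/-- The restriction `f|_{[γ]^n} : [γ]^n → A`, as a set of ordered pairs; the relation `⊆` between
such sets is extension of functions. A function `[γ]^n → A` is throughout given by some
`f : Finset Ordinal → A`, whose values outside `[γ]^n` are irrelevant. -/
def restrict {A : Type v} (f : Finset Ordinal.{u} → A) (γ : Ordinal.{u}) (n : ℕ) :
    Set (Finset Ordinal.{u} × A) :=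
  {p | p.1 ∈ subsets γ n ∧ p.2 = f p.1}

variable {A : Type v} [AddCommGroup A]

/-- `IsTrivial k γ f`: the function `f : [γ]^(k+1) → A` is `k`-trivial. For `k = 0` this says that
its support is finite. For `k > 0`, `f` is identified with the family of functions
`f_β = f(·, β) : [β]^k → A` (`β < γ`), and triviality says that there is a `t : [γ]^k → A` such
that each `t|_{[β]^k} - f_β` is `(k-1)`-trivial. -/
def IsTrivial : ℕ → Ordinal.{u} → (Finset Ordinal.{u} → A) → Prop
  | 0, γ, f => {σ | σ ∈ subsets γ 1 ∧ f σ ≠ 0}.Finite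
  | k + 1, γ, f => ∃ t : Finset Ordinal.{u} → A, ∀ β < γ,
      IsTrivial k β (fun σ => t σ - f (insert β σ))

/-- `k`-triviality on `γ` depends only on the values on `[γ]^(k+1)`. -/
theorem IsTrivial.congr {k : ℕ} {γ : Ordinal.{u}} {f g : Finset Ordinal.{u} → A}
    (hf : IsTrivial k γ f) (h : ∀ σ ∈ subsets γ (k + 1), f σ = g σ) : IsTrivial k γ g := by
  induction k generalizing γ f g with
  | zero =>
    refine Set.Finite.subset hf ?_
    rintro σ ⟨hσ, hne⟩
    exact ⟨hσ, by rw [h σ hσ]; exact hne⟩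
  | succ k ih =>
    obtain ⟨t, ht⟩ := hf
    refine ⟨t, fun β hβ => ih (ht β hβ) ?_⟩
    rintro σ ⟨hc, hlt⟩
    have hmem : β ∉ σ := fun hb => lt_irrefl _ (hlt β hb)
    have : insert β σ ∈ subsets γ (k + 1 + 1) := by
      refine ⟨by rw [Finset.card_insert_of_notMem hmem, hc], fun α hα => ?_⟩
      rcases Finset.mem_insert.1 hα with rfl | hα
      · exact hβ
      · exact (hlt α hα).trans hβ
    simp only [h _ this]

/-- For `n > 0`, the family of functions `s_γ : [γ]^n → A` (`γ < κ`) is `n`-coherent. -/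
def IsCoherentFamily (n : ℕ) (κ : Ordinal.{u}) (s : Ordinal.{u} → Finset Ordinal.{u} → A) :
    Prop :=
  ∀ γ δ : Ordinal.{u}, γ ≤ δ → δ < κ → IsTrivial (n - 1) γ (fun σ => s δ σ - s γ σ)

/-- The set of nodes of the tree `T(S)` induced by a family `S` of functions `s_γ : [γ]^n → A`
(`γ < κ`), ordered by inclusion: all `s_γ|_{[β]^n}` with `β ≤ γ < κ`. -/
def familyTree (n : ℕ) (κ : Ordinal.{u}) (s : Ordinal.{u} → Finset Ordinal.{u} → A) :
    Set (Set (Finset Ordinal.{u} × A)) :=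
  {x | ∃ β γ : Ordinal.{u}, β ≤ γ ∧ γ < κ ∧ x = restrict (s γ) β n}

/-- The set of nodes of the uniform closure `T*(S)`, ordered by inclusion: all
`u : [γ]^n → A` with `γ < κ` such that `u - s_γ` is `(n-1)`-trivial (`n > 0`). -/
def uniformClosure (n : ℕ) (κ : Ordinal.{u}) (s : Ordinal.{u} → Finset Ordinal.{u} → A) :
    Set (Set (Finset Ordinal.{u} × A)) :=
  {x | ∃ γ < κ, ∃ f : Finset Ordinal.{u} → A,
    IsTrivial (n - 1) γ (fun σ => f σ - s γ σ) ∧ x = restrict f γ n}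

/-- There is a nontrivial `n`-coherent tree of height `ε` of `A`-valued functions (`n > 0`): a tree
`T(S)` of height `ε`, for an `n`-coherent family `S`, such that the uniform closure `T*(S)` has no
cofinal branch. -/
def ExistsNontrivialTree (n : ℕ) (ε : Ordinal.{u}) (A : Type v) [AddCommGroup A] : Prop :=
  ∃ (κ : Ordinal.{u}) (s : Ordinal.{u} → Finset Ordinal.{u} → A),
    IsCoherentFamily n κ s ∧
    TreeHeight (familyTree n κ s) ε ∧
    ¬ HasCofinalBranch.{u} (uniformClosure n κ s)

end CoherentTree

/-! A cofinal branch of the uniform closure amounts to a trivialization of the family, at least when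
`κ` is infinite, and then the tree has height `κ`. The question is thus at which lengths coherent
families can be nontrivial.

Lower bound (`exists_trivialization`, `isTrivial_of_local`): two facts are proved in alternation.
(a) An `m`-level coherent family of length below `ω_(m+1)` is trivial: pass to a cofinal subsequence
of type at most `ω_m` and build ever longer partial trivializations, each extending the previous
ones. At a stage `i < ω_m` the union so far differs from the `i`-th function by something trivial
below each earlier stage, so one needs (b): `m`-triviality passes to suprema of sequences shorter
than `ω_m`. Conversely (b) at level `m + 1` is (a) at level `m`, applied to the sections of the
function.

Existence (`exists_nontrivial`): induct on `n`, replacing the group `B` by a direct sum of copies of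
`B` whose index set contains `ω_(n+1)`. A coherent family of length `ω_(n+1)` is built so that each
stage `i` of cofinality `ω_n` receives a nontrivial function in the fresh coordinate `i`. Given a
trivialization `t` of the whole, a closing-off argument finds such an `i` with `t` vanishing in
coordinate `i` on tuples below `i`, which would make the fresh function trivial. -/

namespace CoherentTree

open Set Ordinal Cardinal

/-! ### Calculus of trivial functions: sums, pullbacks, extensions. -/

section Basic

variable {A : Type v} [AddCommGroup A] {B : Type w} [AddCommGroup B]

theorem subsets_mono {γ δ : Ordinal.{u}} (h : γ ≤ δ) (n : ℕ) : subsets γ n ⊆ subsets δ n :=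
  fun _ hσ => ⟨hσ.1, fun α hα => (hσ.2 α hα).trans_le h⟩

theorem insert_mem_subsets {β γ : Ordinal.{u}} {n : ℕ} {σ : Finset Ordinal.{u}}
    (hσ : σ ∈ subsets β n) (hβ : β < γ) : insert β σ ∈ subsets γ (n + 1) := by
  have hmem : β ∉ σ := fun hb => lt_irrefl _ (hσ.2 β hb)
  refine ⟨by rw [Finset.card_insert_of_notMem hmem, hσ.1], fun α hα => ?_⟩
  rcases Finset.mem_insert.1 hα with rfl | hα
  · exact hβ
  · exact (hσ.2 α hα).trans hβ

theorem IsTrivial.mono {k : ℕ} {γ δ : Ordinal.{u}} {f : Finset Ordinal.{u} → A}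
    (hf : IsTrivial k δ f) (h : γ ≤ δ) : IsTrivial k γ f := by
  cases k with
  | zero => exact Finite.subset hf fun σ hσ => ⟨subsets_mono h 1 hσ.1, hσ.2⟩
  | succ k =>
    obtain ⟨t, ht⟩ := hf
    exact ⟨t, fun β hβ => ht β (hβ.trans_le h)⟩

theorem IsTrivial.map {k : ℕ} {γ : Ordinal.{u}} {f : Finset Ordinal.{u} → A}
    (hf : IsTrivial k γ f) (φ : A →+ B) : IsTrivial k γ (fun σ => φ (f σ)) := by
  induction k generalizing γ f with
  | zero =>
    refine Finite.subset hf fun σ hσ => ⟨hσ.1, fun h => hσ.2 ?_⟩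
    simp only [h, map_zero]
  | succ k ih =>
    obtain ⟨t, ht⟩ := hf
    refine ⟨fun σ => φ (t σ), fun β hβ => ?_⟩
    simpa only [map_sub] using ih (ht β hβ)

theorem isTrivial_zero (k : ℕ) (γ : Ordinal.{u}) :
    IsTrivial k γ (fun _ => (0 : A)) := by
  induction k generalizing γ with
  | zero => simp [IsTrivial]
  | succ k ih => exact ⟨fun _ => 0, fun β _ => by simpa using ih β⟩

theorem IsTrivial.add {k : ℕ} {γ : Ordinal.{u}} {f g : Finset Ordinal.{u} → A}
    (hf : IsTrivial k γ f) (hg : IsTrivial k γ g) : IsTrivial k γ (fun σ => f σ + g σ) := by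
  induction k generalizing γ f g with
  | zero =>
    refine Finite.subset (Finite.union hf hg) fun σ hσ => ?_
    by_cases h : f σ = 0
    · exact Or.inr ⟨hσ.1, fun h' => hσ.2 (by simp [h, h'])⟩
    · exact Or.inl ⟨hσ.1, h⟩
  | succ k ih =>
    obtain ⟨t, ht⟩ := hf
    obtain ⟨r, hr⟩ := hg
    refine ⟨fun σ => t σ + r σ, fun β hβ => ?_⟩
    simpa only [add_sub_add_comm] using ih (ht β hβ) (hr β hβ)

theorem IsTrivial.neg {k : ℕ} {γ : Ordinal.{u}} {f : Finset Ordinal.{u} → A}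
    (hf : IsTrivial k γ f) : IsTrivial k γ (fun σ => - f σ) :=
  hf.map (negAddMonoidHom : A →+ A)

theorem isTrivial_of_eq_zero {k : ℕ} {γ : Ordinal.{u}} {f : Finset Ordinal.{u} → A}
    (h : ∀ σ ∈ subsets γ (k + 1), f σ = 0) : IsTrivial k γ f :=
  (isTrivial_zero k γ).congr fun σ hσ => (h σ hσ).symm

/-- Congruence of functions modulo trivial ones is symmetric. -/
theorem IsTrivial.sub_comm {k : ℕ} {γ : Ordinal.{u}} {f g : Finset Ordinal.{u} → A}
    (h : IsTrivial k γ (fun σ => f σ - g σ)) : IsTrivial k γ (fun σ => g σ - f σ) := by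
  simpa only [neg_sub] using h.neg

/-- Congruence of functions modulo trivial ones is transitive. -/
theorem IsTrivial.sub_trans {k : ℕ} {γ : Ordinal.{u}} {f g h : Finset Ordinal.{u} → A}
    (hfg : IsTrivial k γ (fun σ => f σ - g σ)) (hgh : IsTrivial k γ (fun σ => g σ - h σ)) :
    IsTrivial k γ (fun σ => f σ - h σ) := by
  simpa only [sub_add_sub_cancel] using hfg.add hgh

theorem isTrivial_of_eq_bot (k : ℕ) (f : Finset Ordinal.{u} → A) : IsTrivial k 0 f :=
  isTrivial_of_eq_zero fun σ hσ => by
    obtain ⟨α, hα⟩ := Finset.card_pos.1 ((Nat.succ_pos k).trans_eq hσ.1.symm)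
    exact absurd (hσ.2 α hα) not_lt_zero

theorem image_mem_subsets {n : ℕ} {δ γ : Ordinal.{u}} {c : Ordinal.{u} → Ordinal.{u}}
    (hc : StrictMonoOn c (Iio δ)) (hcγ : ∀ i < δ, c i < γ) {σ : Finset Ordinal.{u}}
    (hσ : σ ∈ subsets δ n) : σ.image c ∈ subsets γ n := by
  refine ⟨?_, ?_⟩
  · rw [Finset.card_image_of_injOn, hσ.1]
    exact hc.injOn.mono fun α hα => hσ.2 α hα
  · simpa using fun α hα => hcγ α (hσ.2 α hα)

/-- The section at `β` of the pullback is the pullback of the section at `c β`, so trivializations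
pull back as well. -/
theorem IsTrivial.comp_image {k : ℕ} {δ γ : Ordinal.{u}} {f : Finset Ordinal.{u} → A}
    (hf : IsTrivial k γ f) {c : Ordinal.{u} → Ordinal.{u}} (hc : StrictMonoOn c (Iio δ))
    (hcγ : ∀ i < δ, c i < γ) : IsTrivial k δ (fun σ => f (σ.image c)) := by
  induction k generalizing γ δ f with
  | zero =>
    refine Finite.of_finite_image (f := fun σ => σ.image c) (Finite.subset hf ?_) ?_
    · rintro _ ⟨σ, hσ, rfl⟩
      exact ⟨image_mem_subsets hc hcγ hσ.1, hσ.2⟩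
    · intro σ hσ τ hτ h
      exact (Finset.image_injOn_powerset_of_injOn (s := σ ∪ τ) (f := c) (hc.injOn.mono (by
        intro α hα
        rcases Finset.mem_union.1 hα with h | h
        · exact hσ.1.2 α h
        · exact hτ.1.2 α h))) (Finset.mem_coe.2 (Finset.mem_powerset.2 Finset.subset_union_left))
        (Finset.mem_coe.2 (Finset.mem_powerset.2 Finset.subset_union_right)) h
  | succ k ih =>
    obtain ⟨t, ht⟩ := hf
    refine ⟨fun σ => t (σ.image c), fun β hβ => ?_⟩
    simpa only [Finset.image_insert] using ih (ht (c β) (hcγ β hβ))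
      (hc.mono (Iio_subset_Iio hβ.le)) fun i hi => hc (hi.trans hβ) hβ hi

theorem sup_id_lt {σ : Finset Ordinal.{u}} {γ : Ordinal.{u}} (hσ : σ.Nonempty)
    (h : ∀ α ∈ σ, α < γ) : σ.sup id < γ := by
  obtain ⟨α, hα, h'⟩ := Finset.exists_mem_eq_sup σ hσ id
  rw [h']
  exact h α hα

theorem sup_id_insert {σ : Finset Ordinal.{u}} {β : Ordinal.{u}} (h : ∀ α ∈ σ, α < β) :
    (insert β σ).sup id = β := by
  rw [Finset.sup_insert, id, sup_eq_left]
  exact Finset.sup_le fun α hα => (h α hα).le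

/-- A `k`-trivial function on `[μ]^(k+1)` extends to a `k`-trivial function on `[ν]^(k+1)`. -/
theorem IsTrivial.exists_extension {k : ℕ} {μ : Ordinal.{u}} {h : Finset Ordinal.{u} → A}
    (hh : IsTrivial k μ h) (ν : Ordinal.{u}) :
    ∃ h' : Finset Ordinal.{u} → A, (∀ σ ∈ subsets μ (k + 1), h' σ = h σ) ∧ IsTrivial k ν h' := by
  classical
  cases k with
  | zero =>
    refine ⟨fun σ => if ∀ α ∈ σ, α < μ then h σ else 0, fun σ hσ => if_pos hσ.2, ?_⟩
    refine Finite.subset hh fun σ hσ => ?_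
    obtain ⟨h1, h2⟩ := hσ
    dsimp only at h2
    split_ifs at h2 with h3
    · exact ⟨⟨h1.1, h3⟩, h2⟩
    · exact absurd rfl h2
  | succ k =>
    obtain ⟨t, ht⟩ := hh
    -- For `β ≥ μ` the section at `β` is defined to be `t` itself, so the old `t` still works and
    -- the new differences are zero.
    refine ⟨fun σ => if ∀ α ∈ σ, α < μ then h σ else t (σ.erase (σ.sup id)),
      fun σ hσ => if_pos hσ.2, t, fun β _ => ?_⟩
    rcases lt_or_ge β μ with hβ | hβ
    · refine (ht β hβ).congr fun σ hσ => ?_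
      dsimp only
      rw [if_pos (insert_mem_subsets hσ hβ).2]
    · refine isTrivial_of_eq_zero fun σ hσ => ?_
      dsimp only
      rw [if_neg fun h' : ∀ α ∈ insert β σ, α < μ =>
          (h' β (Finset.mem_insert_self _ _)).not_ge hβ, sup_id_insert hσ.2,
        Finset.erase_insert fun h => lt_irrefl _ (hσ.2 β h), _root_.sub_self]

end Basic

/-! ### Transfinite recursion and gluing. -/

section Choice

/-- Transfinite dependent choice of a family satisfying unary and binary constraints. -/
theorem exists_seq {X : Type w} [Nonempty X] (U : Ordinal.{u} → X → Prop)
    (R : Ordinal.{u} → Ordinal.{u} → X → X → Prop) (θ : Ordinal.{u})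
    (h : ∀ i < θ, ∀ F : Ordinal.{u} → X, (∀ j < i, U j (F j)) →
      (∀ k j, k < j → j < i → R k j (F k) (F j)) → ∃ x, U i x ∧ ∀ j < i, R j i (F j) x) :
    ∃ F : Ordinal.{u} → X, (∀ i < θ, U i (F i)) ∧
      ∀ j i, j < i → i < θ → R j i (F j) (F i) := by
  classical
  let step : ∀ i : Ordinal.{u}, (∀ j, j < i → X) → X := fun i G =>
    Classical.epsilon fun x => U i x ∧ ∀ j, ∀ hj : j < i, R j i (G j hj) x
  let F : Ordinal.{u} → X := WellFounded.fix Ordinal.lt_wf step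
  have hF : ∀ i, F i = Classical.epsilon fun x => U i x ∧ ∀ j, j < i → R j i (F j) x :=
    fun i => WellFounded.fix_eq _ _ _
  have key : ∀ i < θ, U i (F i) ∧ ∀ j < i, R j i (F j) (F i) := by
    intro i
    induction i using WellFoundedLT.induction with
    | ind i ih =>
      intro hi
      obtain ⟨x, hx⟩ := h i hi F (fun j hj => (ih j hj (hj.trans hi)).1)
        fun k j hk hj => (ih j hj (hj.trans hi)).2 k hk
      rw [hF i]
      exact Classical.epsilon_spec (p := fun x => U i x ∧ ∀ j, j < i → R j i (F j) x) ⟨x, hx⟩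
  exact ⟨F, fun i hi => (key i hi).1, fun j i hj hi => (key i hi).2 j hj⟩

/-- Functions that agree on increasing domains have a common extension. -/
theorem exists_glue {X : Type v} {Y : Type w} (D : Ordinal.{u} → Set X)
    (F : Ordinal.{u} → X → Y) (θ : Ordinal.{u})
    (hF : ∀ j i, j < i → i < θ → ∀ x ∈ D j, F i x = F j x) [Nonempty Y] :
    ∃ f : X → Y, ∀ i < θ, ∀ x ∈ D i, f x = F i x := by
  classical
  have : ∀ x, ∃ y, ∀ i < θ, x ∈ D i → y = F i x := by
    intro x
    by_cases h : ∃ i, i < θ ∧ x ∈ D i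
    · obtain ⟨i, ⟨hi, hx⟩, hmin⟩ := WellFounded.has_min Ordinal.lt_wf {i | i < θ ∧ x ∈ D i} h
      refine ⟨F i x, fun j hj hxj => ?_⟩
      rcases (not_lt.1 (hmin j ⟨hj, hxj⟩)).eq_or_lt with rfl | hij
      · rfl
      · exact (hF i j hij hj x hx).symm
    · exact ⟨Classical.arbitrary Y, fun i hi hx => absurd ⟨i, hi, hx⟩ h⟩
  choose f hf using this
  exact ⟨f, fun i hi x hx => hf x i hi hx⟩

end Choice

/-! ### Short coherent families are trivial. -/

section Vanishing

variable {A : Type v} [AddCommGroup A]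

theorem exists_cofinal_strictMonoOn (θ : Ordinal.{u}) :
    ∃ e : Ordinal.{u} → Ordinal.{u}, StrictMonoOn e (Iio θ.cof.ord) ∧
      (∀ k < θ.cof.ord, e k < θ) ∧ ∀ i < θ, ∃ k < θ.cof.ord, i ≤ e k := by
  classical
  obtain ⟨f, hf⟩ := exists_isFundamentalSeq (o := θ) rfl
  refine ⟨fun k => if h : k ∈ Iio θ.cof.ord then f ⟨k, h⟩ else 0, fun a ha b hb hab => ?_,
    fun k hk => ?_, fun i hi => ?_⟩
  · simp only [ha, hb, dif_pos]
    have h : (⟨a, ha⟩ : Iio θ.cof.ord) < ⟨b, hb⟩ := hab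
    exact hf.strictMono h
  · dsimp only
    rw [dif_pos (show k ∈ Iio θ.cof.ord from hk)]
    exact (f ⟨k, hk⟩).2
  · obtain ⟨_, ⟨k, rfl⟩, hk⟩ := hf.isCofinal_range ⟨i, hi⟩
    exact ⟨k, k.2, by simpa only [dif_pos k.2] using Subtype.coe_le_coe.2 hk⟩

theorem lt_omega_succ_iff {θ : Ordinal.{u}} {m : ℕ} :
    θ < omega ((m + 1 : ℕ) : Ordinal.{u}) ↔ θ.card ≤ aleph (m : Ordinal.{u}) := by
  rw [lt_omega_iff_card_lt, Nat.cast_succ, ← succ_aleph, Order.lt_succ_iff]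

/-- A coherent family indexed by an ordinal of at most `ω_m` is trivial, provided that local
triviality along shorter sequences implies triviality. -/
theorem exists_trivialization_of_le_omega (m : ℕ)
    (hloc : ∀ (θ μ : Ordinal.{u}) (c : Ordinal.{u} → Ordinal.{u}) (h : Finset Ordinal.{u} → A),
      θ < omega (m : Ordinal.{u}) → StrictMonoOn c (Iio θ) →
      (∀ j < θ, IsTrivial m (c j) h) → (∀ β < μ, ∃ j < θ, β < c j) → IsTrivial m μ h)
    (θ : Ordinal.{u}) (hθ : θ ≤ omega (m : Ordinal.{u})) (c : Ordinal.{u} → Ordinal.{u})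
    (hc : StrictMonoOn c (Iio θ)) (S : Ordinal.{u} → Finset Ordinal.{u} → A)
    (hS : ∀ i j, i < j → j < θ → IsTrivial m (c i) (fun σ => S j σ - S i σ)) :
    ∃ t : Finset Ordinal.{u} → A, ∀ i < θ, IsTrivial m (c i) (fun σ => t σ - S i σ) := by
  refine Exists.elim (exists_seq
    (fun i (t : Finset Ordinal.{u} → A) => IsTrivial m (c i) (fun σ => t σ - S i σ))
    (fun j _ (s t : Finset Ordinal.{u} → A) => ∀ σ ∈ subsets (c j) (m + 1), t σ = s σ) θ ?_) ?_
  · intro i hi F hF hFR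
    obtain ⟨f, hf⟩ := exists_glue (fun i => subsets (c i) (m + 1)) F i
      fun j k hjk hk => hFR j k hjk hk
    have hμ : ∀ j < i, c j ≤ ⨆ j : Iio i, c j := fun j hj =>
      Ordinal.le_iSup (fun j : Iio i => c j) ⟨j, hj⟩
    have h := hloc i (⨆ j : Iio i, c j) c (fun σ => f σ - S i σ) (hi.trans_le hθ)
      (hc.mono (Iio_subset_Iio hi.le)) (fun j hj => ?_) (fun β hβ => ?_)
    -- The supremum of the earlier `c j` may lie below `c i`; extending the trivial difference and
    -- adding `S i` back fills the gap without changing the earlier values.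
    · obtain ⟨h', hh', ht⟩ := h.exists_extension (c i)
      refine ⟨fun σ => h' σ + S i σ, by simpa using ht, fun j hj σ hσ => ?_⟩
      dsimp only
      rw [hh' σ (subsets_mono (hμ j hj) _ hσ), sub_add_cancel, hf j hj σ hσ]
    · exact IsTrivial.sub_trans ((hF j hj).congr fun σ hσ => by rw [hf j hj σ hσ])
        (hS j i hj hi).sub_comm
    · obtain ⟨j, hj⟩ := Ordinal.lt_iSup_iff.1 hβ
      exact ⟨j, j.2, hj⟩
  · rintro F ⟨hF, hFR⟩
    obtain ⟨t, ht⟩ := exists_glue (fun i => subsets (c i) (m + 1)) F θ hFR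
    exact ⟨t, fun i hi => (hF i hi).congr fun σ hσ => by rw [ht i hi σ hσ]⟩

/-- A coherent family indexed by an ordinal below `ω_(m+1)` is trivial, provided that local
triviality along sequences of length below `ω_m` implies triviality. -/
theorem exists_trivialization_of_local (m : ℕ)
    (hloc : ∀ (θ μ : Ordinal.{u}) (c : Ordinal.{u} → Ordinal.{u}) (h : Finset Ordinal.{u} → A),
      θ < omega (m : Ordinal.{u}) → StrictMonoOn c (Iio θ) →
      (∀ j < θ, IsTrivial m (c j) h) → (∀ β < μ, ∃ j < θ, β < c j) → IsTrivial m μ h)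
    (θ : Ordinal.{u}) (hθ : θ < omega ((m + 1 : ℕ) : Ordinal.{u})) (c : Ordinal.{u} → Ordinal.{u})
    (hc : StrictMonoOn c (Iio θ)) (S : Ordinal.{u} → Finset Ordinal.{u} → A)
    (hS : ∀ i j, i < j → j < θ → IsTrivial m (c i) (fun σ => S j σ - S i σ)) :
    ∃ t : Finset Ordinal.{u} → A, ∀ i < θ, IsTrivial m (c i) (fun σ => t σ - S i σ) := by
  obtain ⟨e, he, heθ, hcof⟩ := exists_cofinal_strictMonoOn θ
  have hle : θ.cof.ord ≤ omega (m : Ordinal.{u}) := by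
    rw [← ord_aleph, ord_le_ord]
    exact (cof_le_card θ).trans (lt_omega_succ_iff.1 hθ)
  obtain ⟨t, ht⟩ := exists_trivialization_of_le_omega m hloc θ.cof.ord hle (fun k => c (e k))
    (fun a ha b hb hab => hc (heθ a ha) (heθ b hb) (he ha hb hab)) (fun k => S (e k))
    fun i j hij hj => hS _ _ (he (hij.trans hj) hj hij) (heθ j hj)
  refine ⟨t, fun i hi => ?_⟩
  obtain ⟨k, hk, hik⟩ := hcof i hi
  rcases hik.eq_or_lt with rfl | hik
  · exact ht k hk
  · exact IsTrivial.sub_trans ((ht k hk).mono (hc hi (heθ k hk) hik).le) (hS i _ hik (heθ k hk))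

/-- Functions that are `m`-trivial along a sequence of length below `ω_m` are `m`-trivial on its
supremum. -/
theorem isTrivial_of_local (m : ℕ) (θ μ : Ordinal.{u}) (c : Ordinal.{u} → Ordinal.{u})
    (h : Finset Ordinal.{u} → A) (hθ : θ < omega (m : Ordinal.{u})) (hc : StrictMonoOn c (Iio θ))
    (hh : ∀ j < θ, IsTrivial m (c j) h) (hμ : ∀ β < μ, ∃ j < θ, β < c j) : IsTrivial m μ h := by
  induction m generalizing θ μ c h with
  | zero =>
    rw [Nat.cast_zero, omega_zero] at hθ
    obtain ⟨n, rfl⟩ := lt_omega0.1 hθ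
    cases n with
    | zero =>
      refine (isTrivial_of_eq_bot 0 h).mono (not_lt.1 fun h0 => ?_)
      obtain ⟨j, hj, -⟩ := hμ 0 h0
      simp at hj
    | succ n =>
      have hn : (n : Ordinal.{u}) < (n + 1 : ℕ) := by exact_mod_cast Nat.lt_succ_self n
      refine (hh n hn).mono (le_of_forall_lt fun β hβ => ?_)
      obtain ⟨j, hj, hβj⟩ := hμ β hβ
      refine hβj.trans_le (hc.monotoneOn hj hn ?_)
      rwa [Nat.cast_succ, ← Order.succ_eq_add_one, Order.lt_succ_iff] at hj
  | succ m ih =>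
    rcases zero_or_succ_or_isSuccLimit θ with rfl | ⟨j, rfl⟩ | hlim
    · refine (isTrivial_of_eq_bot _ h).mono (not_lt.1 fun h0 => ?_)
      obtain ⟨j, hj, -⟩ := hμ 0 h0
      simp at hj
    · have hj : j < Order.succ j := Order.lt_succ j
      refine (hh j hj).mono (le_of_forall_lt fun β hβ => ?_)
      obtain ⟨i, hi, hβi⟩ := hμ β hβ
      exact hβi.trans_le (hc.monotoneOn hi hj (Order.lt_succ_iff.1 hi))
    -- The sections of `h` at the `c i` form a coherent family: a trivialization `r` of `h` below `c
    -- (j + 1)` approximates the sections at `c i` and `c j` simultaneously.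
    · obtain ⟨t, ht⟩ := exists_trivialization_of_local m ih θ hθ c hc
        (fun i σ => h (insert (c i) σ)) fun i j hij hj => by
          have hj' := hlim.succ_lt hj
          obtain ⟨r, hr⟩ := hh _ hj'
          have hcj := hc hj hj' (Order.lt_succ j)
          have hci := hc (hij.trans hj) hj hij
          exact IsTrivial.sub_trans ((hr _ hcj).mono hci.le).sub_comm (hr _ (hci.trans hcj))
      refine ⟨t, fun β hβ => ?_⟩
      -- A section at an arbitrary `β < c j` is compared with `t` through the section at `c j` and a
      -- common `r`.
      obtain ⟨j, hj, hβj⟩ := hμ β hβ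
      obtain ⟨r, hr⟩ := hh _ (hlim.succ_lt hj)
      have hcj := hc hj (hlim.succ_lt hj) (Order.lt_succ j)
      exact IsTrivial.sub_trans (IsTrivial.sub_trans ((ht j hj).mono hβj.le)
        ((hr _ hcj).mono hβj.le).sub_comm) (hr β (hβj.trans hcj))

/-- Coherent families indexed by an ordinal below `ω_(m+1)` are trivial. -/
theorem exists_trivialization (m : ℕ) (θ : Ordinal.{u})
    (hθ : θ < omega ((m + 1 : ℕ) : Ordinal.{u})) (c : Ordinal.{u} → Ordinal.{u})
    (hc : StrictMonoOn c (Iio θ)) (S : Ordinal.{u} → Finset Ordinal.{u} → A)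
    (hS : ∀ i j, i < j → j < θ → IsTrivial m (c i) (fun σ => S j σ - S i σ)) :
    ∃ t : Finset Ordinal.{u} → A, ∀ i < θ, IsTrivial m (c i) (fun σ => t σ - S i σ) :=
  exists_trivialization_of_local m (isTrivial_of_local m) θ hθ c hc S hS

end Vanishing

/-! ### Nontrivial functions at `ω_n`. -/

section Nonvanishing

theorem mk_finset_toType_lt (n : ℕ) {x : Ordinal.{u}}
    (hx : x < omega ((n + 1 : ℕ) : Ordinal.{u})) :
    #(Finset x.ToType) < (omega ((n + 1 : ℕ) : Ordinal.{u})).cof := by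
  have hreg : (aleph ((n + 1 : ℕ) : Ordinal.{u})).IsRegular := by
    rw [Nat.cast_succ]
    exact isRegular_aleph_add_one _
  rw [hreg.cof_omega_eq]
  rcases finite_or_infinite x.ToType with h | h
  · exact (lt_aleph0_of_finite _).trans_le hreg.aleph0_le
  · rw [mk_finset_of_infinite, mk_toType]
    exact lt_omega_iff_card_lt.1 hx

theorem card_lt_cof_omega_succ (n : ℕ) {x : Ordinal.{u}}
    (hx : x < omega ((n + 1 : ℕ) : Ordinal.{u})) :
    #x.ToType < (omega ((n + 1 : ℕ) : Ordinal.{u})).cof := by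
  have hreg : (aleph ((n + 1 : ℕ) : Ordinal.{u})).IsRegular := by
    rw [Nat.cast_succ]
    exact isRegular_aleph_add_one _
  rw [hreg.cof_omega_eq, mk_toType]
  exact lt_omega_iff_card_lt.1 hx

/-- Supplies indices for the direct sum in the universe of the group, which may differ from that of
the ordinals. -/
theorem exists_injOn_toType (o : Ordinal.{u}) (o' : Ordinal.{v})
    (h : Ordinal.lift.{v} o = Ordinal.lift.{u} o') (ho : o ≠ 0) :
    ∃ ι : Ordinal.{u} → o'.ToType, InjOn ι (Iio o) := by
  have hcard : Cardinal.lift.{v} #o.ToType ≤ Cardinal.lift.{u} #o'.ToType := by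
    rw [mk_toType, mk_toType, lift_card, lift_card, h]
  obtain ⟨f⟩ := Cardinal.lift_mk_le'.1 hcard
  have hne : Nonempty o'.ToType := by
    have : Nonempty o.ToType := nonempty_toType_iff.2 ho
    exact this.map f
  classical
  refine ⟨fun a => if ha : a ∈ Iio o then f (ToType.mk ⟨a, ha⟩) else Classical.arbitrary _,
    fun a ha b hb hab => ?_⟩
  simp only [dif_pos ha, dif_pos hb] at hab
  simpa using hab

variable {J : Type v} {B : Type v} [AddCommGroup B]

/-- Each value of `t` has finite support, and there are fewer than `ω_(n+1)` finite subsets of `x`,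
so regularity bounds all the indices at once. -/
theorem exists_support_bound (n m : ℕ) {ι : Ordinal.{u} → J}
    (hι : InjOn ι (Iio (omega ((n + 1 : ℕ) : Ordinal.{u})))) (t : Finset Ordinal.{u} → J →₀ B)
    {x : Ordinal.{u}} (hx : x < omega ((n + 1 : ℕ) : Ordinal.{u})) :
    ∃ y < omega ((n + 1 : ℕ) : Ordinal.{u}), ∀ σ ∈ subsets x m,
      ∀ j < omega ((n + 1 : ℕ) : Ordinal.{u}), t σ (ι j) ≠ 0 → j < y := by
  classical
  have hb : ∀ σ : Finset Ordinal.{u}, ∃ b < omega ((n + 1 : ℕ) : Ordinal.{u}),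
      ∀ j < omega ((n + 1 : ℕ) : Ordinal.{u}), t σ (ι j) ≠ 0 → j < b := by
    intro σ
    have hfin : {j | j < omega ((n + 1 : ℕ) : Ordinal.{u}) ∧ t σ (ι j) ≠ 0}.Finite := by
      refine Finite.of_finite_image (f := ι)
        ((t σ).support.finite_toSet.subset ?_) (hι.mono fun j hj => hj.1)
      rintro _ ⟨j, hj, rfl⟩
      exact Finsupp.mem_support_iff.2 hj.2
    refine ⟨hfin.toFinset.sup Order.succ, ?_, fun j hj hne => ?_⟩
    · rw [Finset.sup_lt_iff (omega_pos _)]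
      intro j hj
      exact (isSuccLimit_omega _).succ_lt (hfin.mem_toFinset.1 hj).1
    · exact (Order.lt_succ j).trans_le
        (Finset.le_sup (f := Order.succ) (hfin.mem_toFinset.2 ⟨hj, hne⟩))
  choose b hb hbj using hb
  let e : x.ToType → Ordinal.{u} := fun a => (ToType.mk.symm a : Iio x)
  refine ⟨⨆ τ : Finset x.ToType, b (τ.image e),
    iSup_lt_of_lt_cof (mk_finset_toType_lt n hx) fun τ => hb _, fun σ hσ j hj hne => ?_⟩
  obtain ⟨τ, -, rfl⟩ := (Finset.subset_set_image_iff (s := univ) (f := e)).1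
    (fun α hα => ⟨ToType.mk ⟨α, hσ.2 α hα⟩, mem_univ _, by simp [e]⟩ : (σ : Set _) ⊆ e '' univ)
  exact (hbj _ j hj hne).trans_le (Ordinal.le_iSup (fun τ : Finset x.ToType => b (τ.image e)) τ)

/-- There is an ordinal below `ω_(n+1)`, of cofinality `ω_n`, which is closed under taking indices
of nonzero coordinates of `t`. -/
theorem exists_closed_under_support (n m : ℕ) {ι : Ordinal.{u} → J}
    (hι : InjOn ι (Iio (omega ((n + 1 : ℕ) : Ordinal.{u})))) (t : Finset Ordinal.{u} → J →₀ B) :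
    ∃ i < omega ((n + 1 : ℕ) : Ordinal.{u}),
      (∃ d : Ordinal.{u} → Ordinal.{u}, StrictMonoOn d (Iio (omega (n : Ordinal.{u}))) ∧
        (∀ a < omega (n : Ordinal.{u}), d a < i) ∧
        ∀ j < i, ∃ a < omega (n : Ordinal.{u}), j ≤ d a) ∧
      ∀ σ ∈ subsets i (m + 1), t σ (ι i) = 0 := by
  have hlt : omega (n : Ordinal.{u}) < omega ((n + 1 : ℕ) : Ordinal.{u}) :=
    omega_lt_omega.2 (by exact_mod_cast Nat.lt_succ_self n)
  choose! y hy hyj using fun x hx => exists_support_bound n (m + 1) hι t (x := x) hx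
  -- An increasing `ω_n`-sequence in which each term dominates the support bounds `y` of all earlier
  -- ones; its supremum is the required `i`.
  refine Exists.elim (exists_seq (fun _ x => x < omega ((n + 1 : ℕ) : Ordinal.{u}))
    (fun _ _ x z => x < z ∧ y x ≤ z) (omega (n : Ordinal.{u})) ?_) ?_
  · intro a ha F hF _
    refine ⟨⨆ b : a.ToType,
        max (F (ToType.mk.symm b : Iio a)) (y (F (ToType.mk.symm b : Iio a))) + 1,
      iSup_add_one_lt_of_lt_cof (card_lt_cof_omega_succ n (ha.trans hlt)) fun b => ?_,
      fun b hb => ?_⟩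
    · have := hF (ToType.mk.symm b : Iio a) (mem_Iio.1 (ToType.mk.symm b : Iio a).2)
      exact max_lt this (hy _ this)
    · have h := Ordinal.lt_iSup_add_one (fun b : a.ToType =>
        max (F (ToType.mk.symm b : Iio a)) (y (F (ToType.mk.symm b : Iio a)))) (ToType.mk ⟨b, hb⟩)
      simp only [OrderIso.symm_apply_apply] at h
      exact ⟨(le_max_left _ _).trans_lt h, ((le_max_right _ _).trans_lt h).le⟩
  · rintro e ⟨he, her⟩
    have hsucc : ∀ a < omega (n : Ordinal.{u}), Order.succ a < omega (n : Ordinal.{u}) :=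
      fun a ha => (isSuccLimit_omega _).succ_lt ha
    have hle : ∀ a < omega (n : Ordinal.{u}),
        e a ≤ ⨆ b : (omega (n : Ordinal.{u})).ToType, e (ToType.mk.symm b : Iio _) := by
      intro a ha
      have h := Ordinal.le_iSup (fun b : (omega (n : Ordinal.{u})).ToType =>
        e (ToType.mk.symm b : Iio _)) (ToType.mk ⟨a, ha⟩)
      simpa only [OrderIso.symm_apply_apply] using h
    have hcof : ∀ j < ⨆ b : (omega (n : Ordinal.{u})).ToType, e (ToType.mk.symm b : Iio _),
        ∃ a < omega (n : Ordinal.{u}), j < e a := by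
      intro j hj
      obtain ⟨b, hb⟩ := Ordinal.lt_iSup_iff.1 hj
      exact ⟨_, (ToType.mk.symm b : Iio _).2, hb⟩
    have hi : ⨆ b : (omega (n : Ordinal.{u})).ToType, e (ToType.mk.symm b : Iio _) <
        omega ((n + 1 : ℕ) : Ordinal.{u}) :=
      iSup_lt_of_lt_cof (card_lt_cof_omega_succ n hlt)
        fun b => he _ (ToType.mk.symm b : Iio _).2
    generalize (⨆ b : (omega (n : Ordinal.{u})).ToType, e (ToType.mk.symm b : Iio _)) = i
      at hle hcof hi
    refine ⟨i, hi, ⟨e, fun a _ b hb hab => (her a b hab hb).1, fun a ha =>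
      (her a _ (Order.lt_succ a) (hsucc a ha)).1.trans_le (hle _ (hsucc a ha)), fun j hj => ?_⟩,
      fun σ hσ => ?_⟩
    · obtain ⟨a, ha, hja⟩ := hcof j hj
      exact ⟨a, ha, hja.le⟩
    · by_contra hne
      obtain ⟨a, ha, hja⟩ := hcof (σ.sup id)
        (sup_id_lt (Finset.card_pos.1 ((Nat.succ_pos m).trans_eq hσ.1.symm)) hσ.2)
      have hσa : σ ∈ subsets (e a) (m + 1) :=
        ⟨hσ.1, fun α hα => (Finset.le_sup (f := id) hα).trans_lt hja⟩
      exact ((hyj _ (he a ha) σ hσa i hi hne).trans_le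
        (her a _ (Order.lt_succ a) (hsucc a ha)).2).not_ge (hle _ (hsucc a ha))

/-- A coherent family along a sequence of length `ω_(n+1)`, with values in a direct sum, acquiring
at each index of cofinality `ω_n` a new nontrivial coordinate. -/
theorem exists_family (n : ℕ)
    (hB : ∀ c : Ordinal.{u} → Ordinal.{u}, StrictMonoOn c (Iio (omega (n : Ordinal.{u}))) →
      ∃ g : Finset Ordinal.{u} → B, (∀ i < omega (n : Ordinal.{u}), IsTrivial n (c i) g) ∧
        ¬ IsTrivial n (omega (n : Ordinal.{u})) (fun σ => g (σ.image c)))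
    {ι : Ordinal.{u} → J} (hι : InjOn ι (Iio (omega ((n + 1 : ℕ) : Ordinal.{u}))))
    {c : Ordinal.{u} → Ordinal.{u}}
    (hc : StrictMonoOn c (Iio (omega ((n + 1 : ℕ) : Ordinal.{u})))) :
    ∃ S : Ordinal.{u} → Finset Ordinal.{u} → J →₀ B,
      (∀ i < omega ((n + 1 : ℕ) : Ordinal.{u}),
        (∃ d : Ordinal.{u} → Ordinal.{u}, StrictMonoOn d (Iio (omega (n : Ordinal.{u}))) ∧
          (∀ a < omega (n : Ordinal.{u}), d a < i) ∧
          ∀ j < i, ∃ a < omega (n : Ordinal.{u}), j ≤ d a) →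
        ∃ d : Ordinal.{u} → Ordinal.{u}, StrictMonoOn d (Iio (omega (n : Ordinal.{u}))) ∧
          (∀ a < omega (n : Ordinal.{u}), d a < i) ∧
          ¬ IsTrivial n (omega (n : Ordinal.{u}))
            (fun σ => S i (σ.image fun a => c (d a)) (ι i))) ∧
      ∀ j i, j < i → i < omega ((n + 1 : ℕ) : Ordinal.{u}) →
        IsTrivial n (c j) (fun σ => S i σ - S j σ) := by
  classical
  refine Exists.elim (exists_seq
    -- The support condition keeps coordinate `i` unused before stage `i`.
    (fun i (s : Finset Ordinal.{u} → J →₀ B) => (∀ σ a, s σ a ≠ 0 → ∃ j ≤ i, ι j = a) ∧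
      ((∃ d : Ordinal.{u} → Ordinal.{u}, StrictMonoOn d (Iio (omega (n : Ordinal.{u}))) ∧
          (∀ a < omega (n : Ordinal.{u}), d a < i) ∧
          ∀ j < i, ∃ a < omega (n : Ordinal.{u}), j ≤ d a) →
        ∃ d : Ordinal.{u} → Ordinal.{u}, StrictMonoOn d (Iio (omega (n : Ordinal.{u}))) ∧
          (∀ a < omega (n : Ordinal.{u}), d a < i) ∧
          ¬ IsTrivial n (omega (n : Ordinal.{u}))
            (fun σ => s (σ.image fun a => c (d a)) (ι i))))
    (fun j _ (s t : Finset Ordinal.{u} → J →₀ B) => IsTrivial n (c j) (fun σ => t σ - s σ))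
    (omega ((n + 1 : ℕ) : Ordinal.{u})) ?_)
    fun S hS => ⟨S, fun i hi => (hS.1 i hi).2, hS.2⟩
  intro i hi F hF hFR
  have hci : StrictMonoOn c (Iio i) := hc.mono (Iio_subset_Iio hi.le)
  obtain ⟨t₀, ht₀⟩ := exists_trivialization n i hi c hci F hFR
  obtain ⟨t, ht, hts⟩ : ∃ t : Finset Ordinal.{u} → J →₀ B,
      (∀ j < i, IsTrivial n (c j) (fun σ => t σ - F j σ)) ∧
      ∀ σ a, t σ a ≠ 0 → ∃ j < i, ι j = a := by
    -- Projecting to the old coordinates clears coordinate `i` of the trivialization and fixes every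
    -- earlier `F j`.
    let φ : (J →₀ B) →+ (J →₀ B) := Finsupp.filterAddHom fun a => ∃ j < i, ι j = a
    refine ⟨fun σ => φ (t₀ σ), fun j hj => ((ht₀ j hj).map φ).congr fun σ _ => ?_,
      fun σ a h => ?_⟩
    · rw [map_sub]
      congr 1
      refine (Finsupp.filter_eq_self_iff _ _).2 fun a ha => ?_
      obtain ⟨k, hk, rfl⟩ := (hF j hj).1 σ a ha
      exact ⟨k, hk.trans_lt hj, rfl⟩
    · by_contra h'
      exact h (Finsupp.filter_apply_neg _ _ h')
  by_cases hd : ∃ d : Ordinal.{u} → Ordinal.{u}, StrictMonoOn d (Iio (omega (n : Ordinal.{u}))) ∧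
      (∀ a < omega (n : Ordinal.{u}), d a < i) ∧ ∀ j < i, ∃ a < omega (n : Ordinal.{u}), j ≤ d a
  · obtain ⟨d, hd, hdi, hcof⟩ := hd
    obtain ⟨g, hg, hg'⟩ := hB (fun a => c (d a))
      fun a ha b hb hab => hci (hdi a ha) (hdi b hb) (hd ha hb hab)
    refine ⟨fun σ => t σ + Finsupp.single (ι i) (g σ), ⟨fun σ a h => ?_, fun _ =>
      ⟨d, hd, hdi, fun htriv => hg' (htriv.congr fun σ _ => ?_)⟩⟩, fun j hj => ?_⟩
    · by_cases hta : t σ a = 0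
      · refine ⟨i, le_rfl, ?_⟩
        by_contra hne
        exact h (by simp [hta, Finsupp.single_eq_of_ne' hne])
      · obtain ⟨j, hj, rfl⟩ := hts σ a hta
        exact ⟨j, hj.le, rfl⟩
    · have h0 : ∀ τ, t τ (ι i) = 0 := by
        intro τ
        by_contra hne
        obtain ⟨j, hj, hji⟩ := hts τ _ hne
        exact hj.ne (hι (hj.trans hi) hi hji)
      simp [h0]
    -- Coherence survives because `g` is trivial below each `c (d a)` and `d` is cofinal in `i`.
    · obtain ⟨a, ha, hja⟩ := hcof j hj
      have hga : IsTrivial n (c j) g :=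
        (hg a ha).mono (hci.monotoneOn hj (hdi a ha) hja)
      refine ((ht j hj).add (hga.map (Finsupp.singleAddHom (ι i)))).congr fun σ _ => ?_
      simp only [Finsupp.singleAddHom_apply]
      abel
  · exact ⟨t, ⟨fun σ a h => (hts σ a h).imp fun j hj => ⟨hj.1.le, hj.2⟩, fun h => absurd h hd⟩, ht⟩

/-- The family is encoded as one function by splitting off the maximum of a tuple. Nontriviality is
measured along `c` so that the next level can insert the function along any sequence cofinal in a
stage. -/
theorem exists_nontrivial_succ (n : ℕ)
    (hB : ∀ c : Ordinal.{u} → Ordinal.{u}, StrictMonoOn c (Iio (omega (n : Ordinal.{u}))) →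
      ∃ g : Finset Ordinal.{u} → B, (∀ i < omega (n : Ordinal.{u}), IsTrivial n (c i) g) ∧
        ¬ IsTrivial n (omega (n : Ordinal.{u})) (fun σ => g (σ.image c)))
    {ι : Ordinal.{u} → J} (hι : InjOn ι (Iio (omega ((n + 1 : ℕ) : Ordinal.{u}))))
    {c : Ordinal.{u} → Ordinal.{u}}
    (hc : StrictMonoOn c (Iio (omega ((n + 1 : ℕ) : Ordinal.{u})))) :
    ∃ g : Finset Ordinal.{u} → J →₀ B,
      (∀ i < omega ((n + 1 : ℕ) : Ordinal.{u}), IsTrivial (n + 1) (c i) g) ∧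
        ¬ IsTrivial (n + 1) (omega ((n + 1 : ℕ) : Ordinal.{u})) (fun σ => g (σ.image c)) := by
  obtain ⟨S, hS, hSR⟩ := exists_family n hB hι hc
  -- For `β` outside the range of `c`, the section at `β` is taken from the first stage whose `c i`
  -- reaches `β`.
  let idx : Ordinal.{u} → Ordinal.{u} := fun β =>
    sInf {i | i < omega ((n + 1 : ℕ) : Ordinal.{u}) ∧ β ≤ c i}
  have hg : ∀ β, ∀ σ ∈ subsets β (n + 1),
      S (idx ((insert β σ).sup id)) ((insert β σ).erase ((insert β σ).sup id)) = S (idx β) σ := by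
    intro β σ hσ
    rw [sup_id_insert hσ.2, Finset.erase_insert fun h => lt_irrefl _ (hσ.2 β h)]
  refine ⟨fun σ => S (idx (σ.sup id)) (σ.erase (σ.sup id)), fun i hi => ⟨S i, fun β hβ => ?_⟩, ?_⟩
  · have hmem : i ∈ {i | i < omega ((n + 1 : ℕ) : Ordinal.{u}) ∧ β ≤ c i} := ⟨hi, hβ.le⟩
    have hle : idx β ≤ i := csInf_le' hmem
    have hβi : β ≤ c (idx β) := (csInf_mem ⟨i, hmem⟩ : idx β ∈ _).2
    have : IsTrivial n β (fun σ => S i σ - S (idx β) σ) := by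
      rcases hle.eq_or_lt with h | h
      · rw [h]
        exact isTrivial_of_eq_zero fun σ _ => sub_self _
      · exact (hSR _ _ h hi).mono hβi
    exact this.congr fun σ hσ => by dsimp only; rw [hg β σ hσ]
  · rintro ⟨t, ht⟩
    have hidx : ∀ i < omega ((n + 1 : ℕ) : Ordinal.{u}), idx (c i) = i := by
      intro i hi
      have hmem : i ∈ {j | j < omega ((n + 1 : ℕ) : Ordinal.{u}) ∧ c i ≤ c j} := ⟨hi, le_rfl⟩
      refine le_antisymm (csInf_le' hmem) ?_
      have h := (csInf_mem ⟨i, hmem⟩ : idx (c i) ∈ _)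
      exact (hc.le_iff_le hi h.1).1 h.2
    have ht' : ∀ i < omega ((n + 1 : ℕ) : Ordinal.{u}),
        IsTrivial n i (fun σ => t σ - S i (σ.image c)) := by
      refine fun i hi => (ht i hi).congr fun σ hσ => ?_
      have himg : σ.image c ∈ subsets (c i) (n + 1) := image_mem_subsets
        (hc.mono (Iio_subset_Iio hi.le)) (fun j hj => hc (hj.trans hi) hi hj) hσ
      dsimp only
      rw [Finset.image_insert, hg _ _ himg, hidx i hi]
    obtain ⟨i, hi, hd, hti⟩ := exists_closed_under_support n n hι t
    obtain ⟨d, hd, hdi, hnot⟩ := hS i hi hd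
    -- In coordinate `i` the term `t` vanishes, leaving minus the fresh function, which would then
    -- be trivial along `d`.
    refine hnot ((((ht' i hi).map (Finsupp.applyAddHom (ι i))).comp_image hd hdi).neg.congr
      fun σ hσ => ?_)
    simp [hti _ (image_mem_subsets hd hdi hσ), Finset.image_image, Function.comp_def]

/-- Some abelian group admits, along any increasing `ω_n`-sequence, a function that is `n`-trivial
below each term of the sequence but not along the whole sequence. -/
theorem exists_nontrivial (n : ℕ) : ∃ (B : Type v) (_ : AddCommGroup B),
    ∀ c : Ordinal.{u} → Ordinal.{u}, StrictMonoOn c (Iio (omega (n : Ordinal.{u}))) →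
      ∃ g : Finset Ordinal.{u} → B, (∀ i < omega (n : Ordinal.{u}), IsTrivial n (c i) g) ∧
        ¬ IsTrivial n (omega (n : Ordinal.{u})) (fun σ => g (σ.image c)) := by
  classical
  induction n with
  | zero =>
    refine ⟨ULift ℤ, inferInstance, fun c hc => ?_⟩
    rw [Nat.cast_zero, omega_zero] at hc ⊢
    -- The indicator of the range of `c`: finite support below each `c i`, infinite support along
    -- all of `ω`.
    refine ⟨fun σ => if ∃ k < ω, σ = {c k} then 1 else 0, fun i hi => ?_, fun h => ?_⟩
    · have hfin : (Iio i).Finite := by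
        obtain ⟨m, rfl⟩ := lt_omega0.1 hi
        refine (Set.finite_range fun k : Fin m => ((k : ℕ) : Ordinal.{u})).subset fun x hx => ?_
        obtain ⟨k, rfl⟩ := lt_omega0.1 (lt_trans hx hi)
        exact ⟨⟨k, by exact_mod_cast mem_Iio.1 hx⟩, rfl⟩
      refine (hfin.image fun k => ({c k} : Finset Ordinal.{u})).subset fun σ hσ => ?_
      obtain ⟨h1, h2⟩ := hσ
      dsimp only at h2
      split_ifs at h2 with h
      · obtain ⟨k, hk, rfl⟩ := h
        exact ⟨k, (hc.lt_iff_lt hk hi).1 (h1.2 _ (Finset.mem_singleton_self _)), rfl⟩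
      · exact absurd rfl h2
    · have hinj : Function.Injective fun k : ℕ => ({(k : Ordinal.{u})} : Finset Ordinal.{u}) :=
        fun a b hab => by simpa using hab
      refine infinite_range_of_injective hinj (Finite.subset h ?_)
      rintro _ ⟨k, rfl⟩
      refine ⟨⟨by simp, by simp [natCast_lt_omega0]⟩, ?_⟩
      dsimp only
      rw [if_pos ⟨k, natCast_lt_omega0 k, by simp⟩]
      exact one_ne_zero
  | succ n ih =>
    obtain ⟨B, _, hB⟩ := ih
    obtain ⟨ι, hι⟩ := exists_injOn_toType (omega ((n + 1 : ℕ) : Ordinal.{u}))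
      (omega ((n + 1 : ℕ) : Ordinal.{v})) (by simp) (omega_pos _).ne'
    exact ⟨(omega ((n + 1 : ℕ) : Ordinal.{v})).ToType →₀ B, inferInstance,
      fun c hc => exists_nontrivial_succ n hB hι hc⟩

end Nonvanishing

/-! ### Heights of nodes and trees of restricted functions. -/

section Heights

variable {A : Type v}

theorem range_image_mem_subsets {m : ℕ} {δ : Ordinal.{u}} (h : (m : Ordinal.{u}) ≤ δ) :
    (Finset.range m).image (fun k : ℕ => (k : Ordinal.{u})) ∈ subsets δ m := by
  refine ⟨by rw [Finset.card_image_of_injective _ Nat.cast_injective, Finset.card_range], ?_⟩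
  simp only [Finset.mem_image, Finset.mem_range, forall_exists_index, and_imp,
    forall_apply_eq_imp_iff₂]
  exact fun k hk => lt_of_lt_of_le (by exact_mod_cast hk) h

theorem le_of_subsets_subset {m : ℕ} {β γ : Ordinal.{u}} (hβ : (m : Ordinal.{u}) < β)
    (h : subsets β (m + 1) ⊆ subsets γ (m + 1)) : β ≤ γ := by
  by_contra! hlt
  -- If `γ < β`, the set `{0, …, m - 1, max γ m}` is in `[β]^(m+1)` but not in `[γ]^(m+1)`.
  have hmem := h (insert_mem_subsets (range_image_mem_subsets (le_max_right γ (m : Ordinal.{u})))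
    (max_lt hlt hβ))
  exact ((hmem.2 _ (Finset.mem_insert_self _ _)).trans_le (le_max_left _ _)).false

theorem subsets_eq_empty {m : ℕ} {β : Ordinal.{u}} (hβ : β ≤ (m : Ordinal.{u})) :
    subsets β (m + 1) = ∅ := by
  refine eq_empty_of_forall_notMem fun σ hσ => ?_
  have hsub : σ ⊆ (Finset.range m).image (fun k : ℕ => (k : Ordinal.{u})) := by
    intro α hα
    have hlt := (hσ.2 α hα).trans_le hβ
    obtain ⟨k, rfl⟩ := lt_omega0.1 (hlt.trans (natCast_lt_omega0 m))
    exact Finset.mem_image_of_mem _ (Finset.mem_range.2 (by exact_mod_cast hlt))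
  have := (Finset.card_le_card hsub).trans Finset.card_image_le
  rw [hσ.1, Finset.card_range] at this
  exact absurd this (Nat.not_succ_le_self m)

theorem restrict_mono (f : Finset Ordinal.{u} → A) {γ δ : Ordinal.{u}} (h : γ ≤ δ) (n : ℕ) :
    restrict f γ n ⊆ restrict f δ n :=
  fun _ hp => ⟨subsets_mono h n hp.1, hp.2⟩

theorem subsets_subset_of_restrict_subset {f g : Finset Ordinal.{u} → A} {γ δ : Ordinal.{u}}
    {n : ℕ} (h : restrict f γ n ⊆ restrict g δ n) : subsets γ n ⊆ subsets δ n :=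
  fun σ hσ => (h (show (σ, f σ) ∈ restrict f γ n from ⟨hσ, rfl⟩)).1

theorem eq_of_restrict_subset {f g : Finset Ordinal.{u} → A} {γ δ : Ordinal.{u}}
    {n : ℕ} (h : restrict f γ n ⊆ restrict g δ n) {σ : Finset Ordinal.{u}}
    (hσ : σ ∈ subsets γ n) : f σ = g σ :=
  (h (show (σ, f σ) ∈ restrict f γ n from ⟨hσ, rfl⟩)).2

theorem restrict_congr {f g : Finset Ordinal.{u} → A} {γ : Ordinal.{u}} {n : ℕ}
    (h : ∀ σ ∈ subsets γ n, f σ = g σ) : restrict f γ n = restrict g γ n := by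
  ext ⟨σ, a⟩
  refine and_congr_right fun hσ => ?_
  simp only [h σ hσ]

theorem restrict_lt_restrict (f : Finset Ordinal.{u} → A) {m : ℕ} {γ δ : Ordinal.{u}}
    (h : γ < δ) (hm : (m : Ordinal.{u}) < δ) : restrict f γ (m + 1) < restrict f δ (m + 1) :=
  lt_of_le_of_ne (restrict_mono f h.le _) fun heq =>
    (le_of_subsets_subset hm (subsets_subset_of_restrict_subset heq.ge)).not_gt h

theorem nodeHeight_unique {P : Type w} [PartialOrder P] {T : Set P} {t : P} {α β : Ordinal.{u}}
    (hα : NodeHeight T t α) (hβ : NodeHeight T t β) : α = β := by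
  obtain ⟨e⟩ := hα
  obtain ⟨e'⟩ := hβ
  have h := (e.symm.trans e').ordinalType_congr
  simpa using h

/-- The node `f|_{[β]^(m+1)}` has height `β - m`. -/
theorem nodeHeight_restrict {m : ℕ} {T : Set (Set (Finset Ordinal.{u} × A))}
    (hT : ∀ x ∈ T, ∃ (f : Finset Ordinal.{u} → A) (β : Ordinal.{u}), x = restrict f β (m + 1))
    {f : Finset Ordinal.{u} → A} {β : Ordinal.{u}} (hf : ∀ γ ≤ β, restrict f γ (m + 1) ∈ T) :
    NodeHeight T (restrict f β (m + 1)) (β - m) := by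
  have hlt : ∀ α ∈ Iio (β - (m : Ordinal.{u})), (m : Ordinal.{u}) + α < β :=
    fun α hα => Ordinal.lt_sub.1 hα
  -- All restrictions to domains with `γ ≤ m` are the empty function, so distinct nodes are counted
  -- from `m` upwards.
  let F : Iio (β - (m : Ordinal.{u})) → {s // s ∈ T ∧ s < restrict f β (m + 1)} := fun α =>
    ⟨restrict f (m + α) (m + 1), hf _ (hlt α α.2).le,
      restrict_lt_restrict f (hlt α α.2) (le_self_add.trans_lt (hlt α α.2))⟩
  have hmono : StrictMono F := by
    intro α α' h
    have h' : (m : Ordinal.{u}) + α < m + α' := (add_lt_add_iff_left _).2 h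
    exact restrict_lt_restrict f h' (le_self_add.trans_lt h')
  refine ⟨(hmono.orderIsoOfSurjective F ?_).symm⟩
  rintro ⟨s, hsT, hs⟩
  obtain ⟨g, δ, rfl⟩ := hT s hsT
  have hgf : restrict g δ (m + 1) = restrict f δ (m + 1) :=
    restrict_congr fun σ hσ => eq_of_restrict_subset hs.le hσ
  have hδ : δ < β := by
    by_contra! hle
    rw [hgf] at hs
    exact hs.not_ge (restrict_mono f hle _)
  have hm : (m : Ordinal.{u}) < β := by
    by_contra! hle
    refine hs.not_ge fun p hp => ?_
    have := hp.1
    rw [subsets_eq_empty hle] at this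
    exact this.elim
  refine ⟨⟨δ - m, Ordinal.lt_sub.2 ?_⟩, Subtype.ext ?_⟩
  · rcases le_total (m : Ordinal.{u}) δ with h | h
    · rwa [Ordinal.add_sub_cancel_of_le h]
    · rwa [Ordinal.sub_eq_zero_iff_le.2 h, add_zero]
  · change restrict f (m + (δ - m)) (m + 1) = restrict g δ (m + 1)
    rw [hgf]
    rcases le_total (m : Ordinal.{u}) δ with h | h
    · rw [Ordinal.add_sub_cancel_of_le h]
    · rw [Ordinal.sub_eq_zero_iff_le.2 h, add_zero]
      ext p
      simp [restrict, subsets_eq_empty h, subsets_eq_empty le_rfl]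

/-- `T` is a set of functions with domains `[β]^(m+1)`, `β < κ`, closed under restriction. -/
def ClosedUnderRestriction (m : ℕ) (κ : Ordinal.{u}) (T : Set (Set (Finset Ordinal.{u} × A))) :
    Prop :=
  ∀ x ∈ T, ∃ (f : Finset Ordinal.{u} → A) (β : Ordinal.{u}), x = restrict f β (m + 1) ∧ β < κ ∧
    ∀ γ ≤ β, restrict f γ (m + 1) ∈ T

theorem exists_nodeHeight_iff {m : ℕ} {κ : Ordinal.{u}} {T b : Set (Set (Finset Ordinal.{u} × A))}
    (hT : ClosedUnderRestriction m κ T) (hbT : b ⊆ T)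
    (hb : ∀ β < κ, ∃ f : Finset Ordinal.{u} → A, restrict f β (m + 1) ∈ b ∧
      ∀ γ ≤ β, restrict f γ (m + 1) ∈ T) (α : Ordinal.{u}) :
    (∃ t ∈ b, NodeHeight T t α) ↔ ∃ β < κ, α = β - m := by
  have hT' : ∀ x ∈ T, ∃ (f : Finset Ordinal.{u} → A) (β : Ordinal.{u}),
      x = restrict f β (m + 1) := fun x hx => by
    obtain ⟨f, β, h, -⟩ := hT x hx
    exact ⟨f, β, h⟩
  constructor
  · rintro ⟨t, ht, h⟩
    obtain ⟨f, β, rfl, hβ, hf⟩ := hT t (hbT ht)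
    exact ⟨β, hβ, nodeHeight_unique h (nodeHeight_restrict hT' hf)⟩
  · rintro ⟨β, hβ, rfl⟩
    obtain ⟨f, hfb, hf⟩ := hb β hβ
    exact ⟨_, hfb, nodeHeight_restrict hT' hf⟩

/-- The shift by `m` is absorbed: `m + α` stays finite for finite `α` and equals `α` otherwise. -/
theorem exists_lt_eq_sub_iff {κ : Ordinal.{u}} (hκ : ω ≤ κ) (m : ℕ) (α : Ordinal.{u}) :
    (∃ β < κ, α = β - m) ↔ α < κ := by
  constructor
  · rintro ⟨β, hβ, rfl⟩
    exact (Ordinal.sub_le_self _ _).trans_lt hβ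
  · intro hα
    refine ⟨m + α, ?_, (Ordinal.add_sub_cancel _ _).symm⟩
    rcases lt_or_ge α ω with h | h
    · exact (isPrincipal_add_omega0 (natCast_lt_omega0 m) h).trans_le hκ
    · rwa [natCast_add_of_omega0_le h]

theorem treeHeight_iff {m : ℕ} {κ : Ordinal.{u}} (hκ : ω ≤ κ)
    {T : Set (Set (Finset Ordinal.{u} × A))} (hT : ClosedUnderRestriction m κ T)
    (hb : ∀ β < κ, ∃ f : Finset Ordinal.{u} → A, ∀ γ ≤ β, restrict f γ (m + 1) ∈ T)
    (η : Ordinal.{u}) : TreeHeight T η ↔ η = κ := by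
  have h : {α : Ordinal.{u} | ¬ ∃ t ∈ T, NodeHeight T t α} = Ici κ := by
    ext α
    rw [mem_ofPred_eq, exists_nodeHeight_iff hT Subset.rfl
      (fun β hβ => (hb β hβ).imp fun f hf => ⟨hf β le_rfl, hf⟩), exists_lt_eq_sub_iff hκ]
    exact not_lt
  rw [TreeHeight, HeightOfSubset, h]
  exact ⟨fun h => h.unique isLeast_Ici, fun h => h ▸ isLeast_Ici⟩

variable {m : ℕ} {κ : Ordinal.{u}} {s : Ordinal.{u} → Finset Ordinal.{u} → A}

theorem closedUnderRestriction_familyTree :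
    ClosedUnderRestriction m κ (familyTree (m + 1) κ s) := by
  rintro _ ⟨β, γ, hβγ, hγ, rfl⟩
  exact ⟨s γ, β, rfl, hβγ.trans_lt hγ, fun δ hδ => ⟨δ, γ, hδ.trans hβγ, hγ, rfl⟩⟩

theorem treeHeight_familyTree_iff (hκ : ω ≤ κ) (η : Ordinal.{u}) :
    TreeHeight (familyTree (m + 1) κ s) η ↔ η = κ :=
  treeHeight_iff hκ closedUnderRestriction_familyTree
    (fun β hβ => ⟨s β, fun γ hγ => ⟨γ, β, hγ, hβ, rfl⟩⟩) η

end Heights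

/-! ### Cofinal branches versus trivializations. -/

section Trees

variable {A : Type v} [AddCommGroup A] {m : ℕ} {κ : Ordinal.{u}}
  {s : Ordinal.{u} → Finset Ordinal.{u} → A}

theorem restrict_mem_uniformClosure (hs : IsCoherentFamily (m + 1) κ s)
    {f : Finset Ordinal.{u} → A} {β γ : Ordinal.{u}} (hγβ : γ ≤ β) (hβ : β < κ)
    (hf : IsTrivial m β (fun σ => f σ - s β σ)) :
    restrict f γ (m + 1) ∈ uniformClosure (m + 1) κ s :=
  ⟨γ, hγβ.trans_lt hβ, f, IsTrivial.sub_trans (hf.mono hγβ) (hs γ β hγβ hβ), rfl⟩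

theorem closedUnderRestriction_uniformClosure (hs : IsCoherentFamily (m + 1) κ s) :
    ClosedUnderRestriction m κ (uniformClosure (m + 1) κ s) := by
  rintro _ ⟨β, hβ, f, hf, rfl⟩
  exact ⟨f, β, rfl, hβ, fun γ hγ => restrict_mem_uniformClosure hs hγ hβ hf⟩

theorem treeHeight_uniformClosure_iff (hκ : ω ≤ κ) (hs : IsCoherentFamily (m + 1) κ s)
    (η : Ordinal.{u}) : TreeHeight (uniformClosure (m + 1) κ s) η ↔ η = κ :=
  treeHeight_iff hκ (closedUnderRestriction_uniformClosure hs)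
    (fun β hβ => ⟨s β, fun _ hγ => restrict_mem_uniformClosure hs hγ hβ
      (isTrivial_of_eq_zero fun _ _ => sub_self _)⟩) η

/-- A trivialization of a coherent family is a cofinal branch of its uniform closure. -/
theorem hasCofinalBranch_of_trivialization (hs : IsCoherentFamily (m + 1) κ s)
    {t : Finset Ordinal.{u} → A} (ht : ∀ γ < κ, IsTrivial m γ (fun σ => t σ - s γ σ)) :
    HasCofinalBranch.{u} (uniformClosure (m + 1) κ s) := by
  have hmem : ∀ β < κ, restrict t β (m + 1) ∈ uniformClosure (m + 1) κ s :=
    fun β hβ => ⟨β, hβ, t, ht β hβ, rfl⟩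
  have hsub : {x | ∃ β < κ, x = restrict t β (m + 1)} ⊆ uniformClosure (m + 1) κ s := by
    rintro _ ⟨β, hβ, rfl⟩
    exact hmem β hβ
  have hfull : ∀ β < κ, ∃ f : Finset Ordinal.{u} → A,
      restrict f β (m + 1) ∈ {x | ∃ β < κ, x = restrict t β (m + 1)} ∧
        ∀ γ ≤ β, restrict f γ (m + 1) ∈ uniformClosure (m + 1) κ s :=
    fun β hβ => ⟨t, ⟨β, hβ, rfl⟩, fun _ hγ => hmem _ (hγ.trans_lt hβ)⟩
  have hcl := closedUnderRestriction_uniformClosure hs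
  -- Since `κ` may be finite here, the common height is left as an infimum instead of being
  -- identified with `κ`.
  have hne : {α : Ordinal.{u} | ¬ ∃ β < κ, α = β - (m : Ordinal.{u})}.Nonempty :=
    ⟨κ, fun ⟨β, hβ, h⟩ => (h.le.trans (Ordinal.sub_le_self _ _)).not_gt hβ⟩
  refine ⟨{x | ∃ β < κ, x = restrict t β (m + 1)},
    sInf {α : Ordinal.{u} | ¬ ∃ β < κ, α = β - (m : Ordinal.{u})}, ⟨⟨hsub, ?_⟩, ?_⟩, ?_, ?_⟩
  · rintro _ ⟨β, -, rfl⟩ _ ⟨δ, -, rfl⟩ -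
    exact (le_total β δ).imp (fun h => restrict_mono t h _) fun h => restrict_mono t h _
  · rintro c ⟨hcT, hc⟩ hle x hx
    obtain ⟨γ, hγ, f, -, rfl⟩ := hcT hx
    refine ⟨γ, hγ, restrict_congr fun σ hσ => ?_⟩
    rcases hc.total hx (hle ⟨γ, hγ, rfl⟩) with h | h
    · exact eq_of_restrict_subset h hσ
    · exact (eq_of_restrict_subset h hσ).symm
  · rw [TreeHeight, HeightOfSubset]
    simp only [exists_nodeHeight_iff hcl Subset.rfl
      fun β hβ => (hfull β hβ).imp fun _ hf => ⟨hf.2 β le_rfl, hf.2⟩]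
    exact ⟨csInf_mem hne, fun _ h => csInf_le' h⟩
  · rw [HeightOfSubset]
    simp only [exists_nodeHeight_iff hcl hsub hfull]
    exact ⟨csInf_mem hne, fun _ h => csInf_le' h⟩

/-- A cofinal branch of the uniform closure of a coherent family yields a trivialization. -/
theorem exists_trivialization_of_hasCofinalBranch (hκ : ω ≤ κ)
    (hs : IsCoherentFamily (m + 1) κ s)
    (h : HasCofinalBranch.{u} (uniformClosure (m + 1) κ s)) :
    ∃ t : Finset Ordinal.{u} → A, ∀ γ < κ, IsTrivial m γ (fun σ => t σ - s γ σ) := by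
  obtain ⟨b, η, hb, hη, hbη⟩ := h
  obtain rfl := (treeHeight_uniformClosure_iff hκ hs η).1 hη
  have key : ∀ β < η, ∃ (f : Finset Ordinal.{u} → A) (γ : Ordinal.{u}), β ≤ γ ∧ γ < η ∧
      restrict f γ (m + 1) ∈ b ∧ IsTrivial m γ (fun σ => f σ - s γ σ) := by
    intro β hβ
    -- A node of height `β` has domain `[γ]^(m+1)` with `β = γ - m ≤ γ`, so the branch reaches past
    -- every `β`.
    have : ∃ x ∈ b, NodeHeight (uniformClosure (m + 1) η s) x β := by
      by_contra hnot
      exact (hbη.2 hnot).not_gt hβ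
    obtain ⟨x, hx, hxβ⟩ := this
    obtain ⟨γ, hγ, f, hf, rfl⟩ := hb.1.1 hx
    have hh := nodeHeight_unique hxβ (nodeHeight_restrict (fun y hy => by
      obtain ⟨δ, -, g, -, h⟩ := hy
      exact ⟨g, δ, h⟩) fun δ hδ => restrict_mem_uniformClosure hs hδ hγ hf)
    exact ⟨f, γ, hh.le.trans (Ordinal.sub_le_self _ _), hγ, hx, hf⟩
  choose! f γ hβγ hγ hfb hf using key
  obtain ⟨t, ht⟩ := exists_glue (fun β => subsets β (m + 1)) f η fun i j hij hj σ hσ => by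
    have hσi := subsets_mono (hβγ i (hij.trans hj)) _ hσ
    have hσj := subsets_mono (hij.le.trans (hβγ j hj)) _ hσ
    rcases hb.1.2.total (hfb i (hij.trans hj)) (hfb j hj) with h | h
    · exact (eq_of_restrict_subset h hσi).symm
    · exact eq_of_restrict_subset h hσj
  refine ⟨t, fun β hβ => ?_⟩
  refine (IsTrivial.sub_trans ((hf β hβ).mono (hβγ β hβ)) (hs β _ (hβγ β hβ) (hγ β hβ))).congr
    fun σ hσ => ?_
  rw [ht β hβ σ hσ]

/-- The family consists of the sections of `g`; trivializing it is by definition `(n+1)`-triviality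
of `g`. -/
theorem existsNontrivialTree_omega {n : ℕ} {g : Finset Ordinal.{u} → A}
    (hg : ∀ i < omega ((n + 1 : ℕ) : Ordinal.{u}), IsTrivial (n + 1) i g)
    (hg' : ¬ IsTrivial (n + 1) (omega ((n + 1 : ℕ) : Ordinal.{u})) g) :
    ExistsNontrivialTree (n + 1) (omega ((n + 1 : ℕ) : Ordinal.{u})) A := by
  have hs : IsCoherentFamily (n + 1) (omega ((n + 1 : ℕ) : Ordinal.{u}))
      (fun β σ => g (insert β σ)) := by
    intro γ δ hγδ hδ
    obtain ⟨t, ht⟩ := hg _ ((isSuccLimit_omega _).succ_lt hδ)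
    exact IsTrivial.sub_trans ((ht δ (Order.lt_succ δ)).mono hγδ).sub_comm
      (ht γ (hγδ.trans_lt (Order.lt_succ δ)))
  exact ⟨_, _, hs, (treeHeight_familyTree_iff (omega0_le_omega _) _).2 rfl, fun h =>
    hg' (exists_trivialization_of_hasCofinalBranch (omega0_le_omega _) hs h)⟩

theorem ExistsNontrivialTree.omega_le {n : ℕ} {ε : Ordinal.{u}}
    (h : ExistsNontrivialTree (n + 1) ε A) : omega ((n + 1 : ℕ) : Ordinal.{u}) ≤ ε := by
  obtain ⟨κ, s, hs, hε, hbr⟩ := h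
  have hκ : omega ((n + 1 : ℕ) : Ordinal.{u}) ≤ κ := by
    by_contra! hlt
    obtain ⟨t, ht⟩ := exists_trivialization n κ hlt id (strictMono_id.strictMonoOn _) s
      fun i j hij hj => hs i j hij.le hj
    exact hbr (hasCofinalBranch_of_trivialization hs ht)
  rwa [(treeHeight_familyTree_iff ((omega0_le_omega _).trans hκ) ε).1 hε]

end Trees

end CoherentTree

theorem mainTheorem8 (n : ℕ) (hn : 0 < n) :
    IsLeast
      {ε : Ordinal.{u} | ∃ (A : Type v) (_ : AddCommGroup A),
        CoherentTree.ExistsNontrivialTree n ε A}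
      (Ordinal.omega (n : Ordinal.{u})) := by
  obtain ⟨n, rfl⟩ := Nat.exists_eq_succ_of_ne_zero hn.ne'
  refine ⟨?_, ?_⟩
  · obtain ⟨A, hA, h⟩ := CoherentTree.exists_nontrivial.{u, v} (n + 1)
    -- Sequences other than the identity matter only inside the induction.
    obtain ⟨g, hg, hg'⟩ := h id (strictMono_id.strictMonoOn _)
    exact ⟨A, hA, CoherentTree.existsNontrivialTree_omega hg (by simpa using hg')⟩
  · rintro ε ⟨A, _, h⟩
    exact h.omega_le
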